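/- Let $\mathbb{X},\mathbb{Y}$ be countable sets with their discrete $\sigma$-algebras, and let $\mathbb{X}^{\mathbb{Z}},\mathbb{Y}^{\mathbb{Z}}$ carry the product $\sigma$-algebras $\mathcal{X}^{\mathbb{Z}},\mathcal{Y}^{\mathbb{Z}}$ and the shift $(Tx)_i=x_{i+1}$. A probability measure $\mu$ on such a space is called asymptotically mean stationary (AMS) if $\bar\mu(A)=\lim_{n\to\infty}\frac1n\sum_{i=0}^{n-1}\mu(T^{-i}A)$ exists for every measurable set $A$; then $\bar\mu$ is a $T$-invariant probability measure, called the stationary mean of $\mu$. Let $f:\mathbb{X}\to\mathbb{Y}^*$ map symbols to finite (possibly empty) strings, let $|w|$ be the length of a string $w$, and let $f^{\mathbb{Z}}(x)=\ldots f(x_{-1})f(x_0)\,\mathbf{.}\,f(x_1)f(x_2)\ldots$ be the concatenation, in which the first symbol after the dot has index $1$. It belongs to $\mathbb{Y}^{\mathbb{Z}}$ when it is infinite in both directions. Put $S(x,n)=\sum_{i=1}^n|f(x_i)|$ and $\bar l(x)=\lim_{n\to\infty}S(x,n)/n\in[0,\infty]$, and for $A\in\mathcal{Y}^{\mathbb{Z}}$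 put $$F(A,k,x)=\mathbf 1\{f^{\mathbb{Z}}(x)\in\mathbb{Y}^{\mathbb{Z}}\text{ and }T^kf^{\mathbb{Z}}(x)\in A\},\qquad G(A,x)=\sum_{k=0}^{|f(x_1)|-1}F(A,k,x).$$ **Proposition.** Let $\mu$ be an AMS probability measure on $\mathbb{X}^{\mathbb{Z}}$. Suppose that the expansion rate $\bar l$ lies in $(0,\infty)$ $\mu$-almost everywhere. Then $f^{\mathbb{Z}}(x)\in\mathbb{Y}^{\mathbb{Z}}$ for $\mu$-almost every $x$, and the probability measure $\nu=\mu\circ(f^{\mathbb{Z}})^{-1}$ on $\mathbb{Y}^{\mathbb{Z}}$ is AMS. The limit defining $\bar l$ exists $\mu$- and $\bar\mu$-almost everywhere, and for every $A\in\mathcal{Y}^{\mathbb{Z}}$ the stationary mean $\bar\nu$ of $\nu$ satisfies $$\bar\nu(A)=\int\Bigl[\lim_{n\to\infty}\frac1{S(x,n)}\sum_{k=0}^{S(x,n)-1}F(A,k,x)\Bigr]d\mu(x)$$ $$=\int\bar l(x)^{-1}\Bigl[\lim_{n\to\infty}\frac1n\sum_{i=0}^{n-1}G(A,T^ix)\Bigr]d\mu(x)=\int\bar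 l(x)^{-1}\Bigl[\lim_{n\to\infty}\frac1n\sum_{i=0}^{n-1}G(A,T^ix)\Bigr]d\bar\mu(x),$$ where the limits in brackets exist almost everywhere with respect to the measure of integration. -/

import Mathlib

open MeasureTheory Filter Topology
open scoped ENNReal

namespace AMSCoding

/-- The left shift `(T x) i = x (i + 1)` on two-sided sequences. -/
def shift {α : Type*} (x : ℤ → α) : ℤ → α := fun i => x (i + 1)

/-- The Cesàro averages `n⁻¹ ∑_{i < n} μ (T⁻ⁱ A)`. -/
noncomputable def cesaro {α : Type*} [MeasurableSpace α] (μ : Measure (ℤ → α))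
    (A : Set (ℤ → α)) (n : ℕ) : ℝ≥0∞ :=
  (∑ i ∈ Finset.range n, μ (shift^[i] ⁻¹' A)) / (n : ℝ≥0∞)

/-- Asymptotic mean stationarity: the Cesàro averages converge on every measurable set.
(For a probability measure they lie in `[0, 1]`, so the limits are finite.) -/
def IsAMS {α : Type*} [MeasurableSpace α] (μ : Measure (ℤ → α)) : Prop :=
  ∀ A : Set (ℤ → α), MeasurableSet A → ∃ a : ℝ≥0∞, Tendsto (cesaro μ A) atTop (𝓝 a)

/-- The measure `m` is the stationary mean of `μ`: on every measurable set its value is the limit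
of the Cesàro averages. Such an `m` is unique. -/
def IsStationaryMean {α : Type*} [MeasurableSpace α] (μ m : Measure (ℤ → α)) : Prop :=
  ∀ A : Set (ℤ → α), MeasurableSet A → Tendsto (cesaro μ A) atTop (𝓝 (m A))

section Coding

variable {X Y : Type*}

/-- The string `f*(x_k x_{k+1} … x_{k+n-1}) = f(x_k) f(x_{k+1}) … f(x_{k+n-1})`. -/
def block (f : X → List Y) (x : ℤ → X) (k : ℤ) (n : ℕ) : List Y :=
  (List.range n).flatMap fun i : ℕ => f (x (k + (i : ℤ)))

/-- The sequences `x` for which `… f(x_{-1}) f(x_0) . f(x_1) f(x_2) …` is infinite in both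
directions, i.e. for which `f^ℤ(x)` belongs to `Y^ℤ`. -/
def codeDomain (f : X → List Y) : Set (ℤ → X) :=
  {x | (∀ N : ℕ, ∃ n : ℕ, N < (block f x 1 n).length) ∧
    ∀ N : ℕ, ∃ m : ℕ, N < (block f x (1 - m) m).length}

/-- The coded sequence `f^ℤ(x) = … f(x_{-1}) f(x_0) . f(x_1) f(x_2) …`, where the symbol right
after the dot has index `1`: for `k ≥ 1` its `k`-th symbol is the `k`-th symbol of
`f(x_1) … f(x_n)` for the least `n` for which this string is long enough, and for `k ≤ 0` it is
the `(1 - k)`-th symbol from the end of `f(x_{1-m}) … f(x_0)` for the least such `m`. -/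
def code (f : X → List Y) (x : codeDomain f) : ℤ → Y := fun k =>
  if 1 ≤ k then
    (block f x.1 1 (Nat.find (x.2.1 (k - 1).toNat)))[(k - 1).toNat]'
      (Nat.find_spec (x.2.1 (k - 1).toNat))
  else
    (block f x.1 (1 - (Nat.find (x.2.2 (-k).toNat) : ℕ))
        (Nat.find (x.2.2 (-k).toNat))).reverse[(-k).toNat]'
      (by rw [List.length_reverse]; exact Nat.find_spec (x.2.2 (-k).toNat))

/-- The transported measure `ν = μ ∘ (f^ℤ)⁻¹` on `Y^ℤ`, that is,
`ν A = μ {x | f^ℤ(x) ∈ Y^ℤ and f^ℤ(x) ∈ A}` for measurable `A`. -/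
noncomputable def codedMeasure [MeasurableSpace X] [MeasurableSpace Y] (f : X → List Y)
    (μ : Measure (ℤ → X)) : Measure (ℤ → Y) :=
  (μ.comap (Subtype.val : codeDomain f → (ℤ → X))).map (code f)

/-- `S(x, n) = ∑_{i=1}^n |f(x_i)|`. -/
def totalLength (f : X → List Y) (x : ℤ → X) (n : ℕ) : ℕ :=
  ∑ i ∈ Finset.range n, (f (x ((i : ℤ) + 1))).length

/-- The expansion rate `lim_n S(x, n) / n`, a limit in `[0, ∞]`. -/
noncomputable def expansionRate (f : X → List Y) (x : ℤ → X) : ℝ≥0∞ :=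
  limUnder atTop fun n : ℕ => (totalLength f x n : ℝ≥0∞) / (n : ℝ≥0∞)

/-- `F(A, k, x)`: the indicator of `T^k f^ℤ(x) ∈ A`. -/
noncomputable def F (f : X → List Y) (A : Set (ℤ → Y)) (k : ℕ) (x : ℤ → X) : ℝ≥0∞ :=
  {z : ℤ → X | ∃ h : z ∈ codeDomain f, shift^[k] (code f ⟨z, h⟩) ∈ A}.indicator 1 x

/-- `G(A, x) = ∑_{k=0}^{|f(x_1)|-1} F(A, k, x)`. -/
noncomputable def G (f : X → List Y) (A : Set (ℤ → Y)) (x : ℤ → X) : ℝ≥0∞ :=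
  ∑ k ∈ Finset.range (f (x 1)).length, F f A k x

/-- The frequency `S(x, n)⁻¹ ∑_{k=0}^{S(x, n)-1} F(A, k, x)`. -/
noncomputable def freqF (f : X → List Y) (A : Set (ℤ → Y)) (x : ℤ → X) (n : ℕ) : ℝ≥0∞ :=
  (∑ k ∈ Finset.range (totalLength f x n), F f A k x) / (totalLength f x n : ℝ≥0∞)

/-- The average `n⁻¹ ∑_{i=0}^{n-1} G(A, T^i x)`. -/
noncomputable def avgG (f : X → List Y) (A : Set (ℤ → Y)) (x : ℤ → X) (n : ℕ) : ℝ≥0∞ :=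
  (∑ i ∈ Finset.range n, G f A (shift^[i] x)) / (n : ℝ≥0∞)

end Coding

end AMSCoding

namespace AMSCoding

section SetwiseLimit

variable {Ω : Type*} [MeasurableSpace Ω]

/-- Setwise limits of finite measures are continuous at `∅` (a form of Nikodym's convergence
theorem), proved by a gliding hump. -/
theorem tendsto_zero_of_antitone_of_setwise_tendsto (P : ℕ → Measure Ω)
    [∀ n, IsFiniteMeasure (P n)] (m : Set Ω → ℝ)
    (hm : ∀ A, MeasurableSet A → Tendsto (fun n => (P n).real A) atTop (𝓝 (m A)))
    (R : ℕ → Set Ω) (hR : ∀ k, MeasurableSet (R k)) (hanti : Antitone R)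
    (hempty : ⋂ k, R k = ∅) : Tendsto (fun k => m (R k)) atTop (𝓝 0) := by
  have hmono : Antitone fun k => m (R k) := fun i j hij =>
    le_of_tendsto_of_tendsto' (hm _ (hR j)) (hm _ (hR i)) fun n => measureReal_mono (hanti hij)
  have hnonneg : ∀ k, 0 ≤ m (R k) := fun k => ge_of_tendsto' (hm _ (hR k)) fun n => by positivity
  have hbdd : BddBelow (Set.range fun k => m (R k)) := ⟨0, by rintro _ ⟨k, rfl⟩; exact hnonneg k⟩
  have hlim := tendsto_atTop_ciInf hmono hbdd
  set δ := ⨅ k, m (R k) with hδ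
  have hδle : ∀ k, δ ≤ m (R k) := fun k => ciInf_le hbdd k
  have hδ0 : 0 ≤ δ := le_ciInf hnonneg
  rcases hδ0.eq_or_lt with h0 | hpos
  · rwa [← h0] at hlim
  exfalso
  obtain ⟨K, hK⟩ : ∃ K, m (R K) < δ + δ / 6 :=
    (hlim.eventually (gt_mem_nhds (by linarith : δ < δ + δ / 6))).exists
  have step : ∀ k N : ℕ, ∃ n k' : ℕ, N ≤ n ∧ k ≤ k' ∧ δ - δ / 6 < (P n).real (R (K + k)) ∧
      (P n).real (R K \ R (K + k)) < δ / 6 ∧ (P n).real (R (K + k')) < δ / 6 := by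
    intro k N
    have h1 : ∀ᶠ n in atTop, δ - δ / 6 < (P n).real (R (K + k)) :=
      (hm _ (hR _)).eventually (lt_mem_nhds (by linarith [hδle (K + k)]))
    have h2 : ∀ᶠ n in atTop, (P n).real (R K) - (P n).real (R (K + k)) < δ / 6 :=
      ((hm _ (hR _)).sub (hm _ (hR _))).eventually
        (gt_mem_nhds (by linarith [hδle (K + k)]))
    obtain ⟨n, hn1, hn2, hnN⟩ := (h1.and (h2.and (eventually_ge_atTop N))).exists
    have h3 : Tendsto (fun j => (P n).real (R j)) atTop (𝓝 0) := by
      have := tendsto_measure_iInter_atTop (μ := P n) (fun j => (hR j).nullMeasurableSet) hanti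
        ⟨0, measure_ne_top _ _⟩
      rw [hempty, measure_empty] at this
      exact (ENNReal.tendsto_toReal ENNReal.zero_ne_top).comp this
    have h4 : Tendsto (fun j => (P n).real (R (K + j))) atTop (𝓝 0) :=
      h3.comp (tendsto_atTop_mono (fun j => Nat.le_add_left j K) tendsto_id)
    obtain ⟨k', hk', hkk⟩ := ((h4.eventually (gt_mem_nhds (by linarith : (0:ℝ) < δ / 6))).and
      (eventually_ge_atTop k)).exists
    refine ⟨n, k', hnN, hkk, hn1, ?_, hk'⟩
    rwa [measureReal_sdiff (hanti (Nat.le_add_right K k)) (hR _)]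
  choose ν κ hν hκ h1 h2 h3 using step
  let ks : ℕ → ℕ := fun j => Nat.rec 0 (fun j k => κ k j) j
  have hks : ∀ j, ks (j + 1) = κ (ks j) j := fun j => rfl
  have hksm : Monotone ks := monotone_nat_of_le_succ fun j => by rw [hks]; exact hκ _ _
  have hns : Tendsto (fun j => ν (ks j) j) atTop atTop :=
    tendsto_atTop_mono (fun j => hν (ks j) j) tendsto_id
  set E : Set Ω := ⋃ i, R (K + ks (2 * i)) \ R (K + ks (2 * i + 1)) with hE
  have hEm : MeasurableSet E := MeasurableSet.iUnion fun i =>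
    (hR (K + ks (2 * i))).diff (hR (K + ks (2 * i + 1)))
  have hRR : ∀ {i j}, i ≤ j → R (K + ks j) ⊆ R (K + ks i) := fun h =>
    hanti (Nat.add_le_add_left (hksm h) K)
  have heven : δ - δ / 6 - δ / 6 ≤ m E := by
    have ht : Tendsto (fun j => 2 * j) atTop (atTop : Filter ℕ) :=
      tendsto_atTop_mono (fun j => by simp; omega) tendsto_id
    refine ge_of_tendsto' ((hm E hEm).comp (hns.comp ht)) fun j => ?_
    have hsub : R (K + ks (2 * j)) \ R (K + ks (2 * j + 1)) ⊆ E :=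
      Set.subset_iUnion (fun i => R (K + ks (2 * i)) \ R (K + ks (2 * i + 1))) j
    refine le_trans ?_ (measureReal_mono hsub)
    rw [measureReal_sdiff (hRR (Nat.le_succ _)) (hR _)]
    have a := h1 (ks (2 * j)) (2 * j)
    have b := h3 (ks (2 * j)) (2 * j)
    rw [← hks] at b
    simp only [Function.comp]
    linarith
  have hodd : m E ≤ δ / 6 + δ / 6 := by
    have ht : Tendsto (fun j => 2 * j + 1) atTop (atTop : Filter ℕ) :=
      tendsto_atTop_mono (fun j => by simp; omega) tendsto_id
    refine le_of_tendsto' ((hm E hEm).comp (hns.comp ht)) fun j => ?_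
    have hsub : E ⊆ (R K \ R (K + ks (2 * j + 1))) ∪ R (K + ks (2 * j + 1 + 1)) := by
      refine Set.iUnion_subset fun i x hx => ?_
      rcases le_or_gt i j with hij | hij
      · exact Or.inl ⟨hanti (Nat.le_add_right _ _) hx.1, fun h =>
          hx.2 (hRR (by omega : 2 * i + 1 ≤ 2 * j + 1) h)⟩
      · exact Or.inr (hRR (by omega : 2 * j + 1 + 1 ≤ 2 * i) hx.1)
    refine (measureReal_mono hsub).trans ((measureReal_union_le _ _).trans ?_)
    have a := h2 (ks (2 * j + 1)) (2 * j + 1)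
    have b := h3 (ks (2 * j + 1)) (2 * j + 1)
    exact add_le_add a.le b.le
  linarith

/-- A finite setwise limit of finite measures is a measure. -/
theorem exists_measure_of_setwise_tendsto (P : ℕ → Measure Ω)
    [∀ n, IsFiniteMeasure (P n)] (m : Set Ω → ℝ≥0∞)
    (hm : ∀ A, MeasurableSet A → Tendsto (fun n => P n A) atTop (𝓝 (m A)))
    (hfin : ∀ A, MeasurableSet A → m A ≠ ∞) :
    ∃ M : Measure Ω, ∀ A, MeasurableSet A → M A = m A := by
  have hempty : m ∅ = 0 := tendsto_nhds_unique (hm ∅ MeasurableSet.empty) (by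
    simp only [measure_empty]; exact tendsto_const_nhds)
  have hunion : ∀ A B, MeasurableSet A → MeasurableSet B → Disjoint A B →
      m (A ∪ B) = m A + m B := fun A B hA hB hd =>
    tendsto_nhds_unique (hm _ (hA.union hB))
      (((hm _ hA).add (hm _ hB)).congr fun n => (measure_union hd hB).symm)
  refine ⟨Measure.ofMeasurable (fun s _ => m s) hempty fun f hf hd => ?_,
    fun A hA => Measure.ofMeasurable_apply A hA⟩
  let R : ℕ → Set Ω := fun k => ⋃ i, f (i + k)
  have hR : ∀ k, MeasurableSet (R k) := fun k => MeasurableSet.iUnion fun i => hf _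
  have hanti : Antitone R := fun i j hij => Set.iUnion_subset fun l x hx =>
    Set.mem_iUnion.2 ⟨l + j - i, by rwa [Nat.sub_add_cancel (by omega)]⟩
  have hint : ⋂ k, R k = ∅ := by
    refine Set.eq_empty_iff_forall_notMem.2 fun x hx => ?_
    rw [Set.mem_iInter] at hx
    obtain ⟨i, hi⟩ := Set.mem_iUnion.1 (hx 0)
    obtain ⟨j, hj⟩ := Set.mem_iUnion.1 (hx (i + 0 + 1))
    exact Set.disjoint_left.1 (hd (by omega : i + 0 ≠ j + (i + 0 + 1))) hi hj
  have hsplit : ∀ k, m (⋃ i, f i) = ∑ i ∈ Finset.range k, m (f i) + m (R k) := by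
    intro k
    induction k with
    | zero => simp [R]
    | succ k ih =>
      have : R k = f k ∪ R (k + 1) := by
        ext x
        simp only [R, Set.mem_iUnion, Set.mem_union]
        constructor
        · rintro ⟨i, hi⟩
          rcases i with _ | i
          · left; simpa using hi
          · right; exact ⟨i, by rwa [show i + (k + 1) = i + 1 + k by ring]⟩
        · rintro (h | ⟨i, hi⟩)
          · exact ⟨0, by simpa using h⟩
          · exact ⟨i + 1, by rwa [show i + 1 + k = i + (k + 1) by ring]⟩
      rw [ih, this, hunion _ _ (hf k) (hR _), Finset.sum_range_succ, add_assoc]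
      exact Set.disjoint_iUnion_right.2 fun i => hd (by omega)
  have htail : Tendsto (fun k => m (R k)) atTop (𝓝 0) := by
    have := tendsto_zero_of_antitone_of_setwise_tendsto P (fun A => (m A).toReal)
      (fun A hA => (ENNReal.tendsto_toReal (hfin A hA)).comp (hm A hA)) R hR hanti hint
    exact (ENNReal.tendsto_toReal_zero_iff fun k => hfin _ (hR k)).1 this
  refine tendsto_nhds_unique (f := fun _ : ℕ => m (⋃ i, f i)) (l := atTop)
    tendsto_const_nhds ?_
  have := ENNReal.tendsto_nat_tsum (fun i => m (f i)) |>.add htail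
  rw [add_zero] at this
  exact this.congr fun k => (hsplit k).symm

end SetwiseLimit

section Birkhoff

variable {Ω : Type*} {T : Ω → Ω} {g : Ω → ℝ}

/-- The maximum of `0` and the first `n` Birkhoff sums of `g`. -/
noncomputable def maxSum (T : Ω → Ω) (g : Ω → ℝ) : ℕ → Ω → ℝ
  | 0 => fun _ => 0
  | n + 1 => fun x => max 0 (g x + maxSum T g n (T x))

theorem maxSum_nonneg (n : ℕ) (x : Ω) : 0 ≤ maxSum T g n x := by
  cases n with
  | zero => exact le_rfl
  | succ n => exact le_max_left _ _

theorem maxSum_le_succ (n : ℕ) : ∀ x, maxSum T g n x ≤ maxSum T g (n + 1) x := by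
  induction n with
  | zero => exact maxSum_nonneg 1
  | succ n ih => exact fun x => max_le_max le_rfl (add_le_add le_rfl (ih (T x)))

theorem birkhoffSum_le_maxSum (n : ℕ) : ∀ x, birkhoffSum T g n x ≤ maxSum T g n x := by
  induction n with
  | zero => intro x; simp [maxSum]
  | succ n ih =>
    intro x
    rw [birkhoffSum_succ']
    exact (add_le_add le_rfl (ih (T x))).trans (le_max_right _ _)

theorem maxSum_eq_zero_of_notMem {C : Set Ω} (hinv : T ⁻¹' C = C) (hg : ∀ x ∉ C, g x = 0)
    (n : ℕ) : ∀ x ∉ C, maxSum T g n x = 0 := by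
  induction n with
  | zero => intro x _; rfl
  | succ n ih =>
    intro x hx
    have hT : T x ∉ C := fun h => hx (by rw [← hinv]; exact h)
    simp [maxSum, hg x hx, ih _ hT]

/-- The points at which the Birkhoff sums of `g` are unbounded above. -/
def unboundedSums (T : Ω → Ω) (g : Ω → ℝ) : Set Ω :=
  {x | ∀ K : ℕ, ∃ n, (K : ℝ) < birkhoffSum T g n x}

theorem preimage_unboundedSums (T : Ω → Ω) (g : Ω → ℝ) :
    T ⁻¹' unboundedSums T g = unboundedSums T g := by
  ext x
  constructor
  · intro h K
    obtain ⟨L, hL⟩ := exists_nat_ge (-g x)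
    obtain ⟨n, hn⟩ := h (K + L)
    push_cast at hn
    exact ⟨n + 1, by rw [birkhoffSum_succ']; linarith⟩
  · intro h K
    obtain ⟨L, hL⟩ := exists_nat_ge (g x)
    obtain ⟨n, hn⟩ := h (K + L)
    push_cast at hn
    rcases n with _ | n
    · rw [birkhoffSum_zero] at hn
      have : (0 : ℝ) ≤ K + L := by positivity
      linarith
    · rw [birkhoffSum_succ'] at hn
      exact ⟨n, by linarith⟩

theorem birkhoffSum_const_sub (h : Ω → ℝ) (a : ℝ) (n : ℕ) (x : Ω) :
    birkhoffSum T (fun y => a - h y) n x = n * a - birkhoffSum T h n x := by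
  simp [birkhoffSum, Finset.sum_sub_distrib]

theorem birkhoffSum_sub_const (h : Ω → ℝ) (a : ℝ) (n : ℕ) (x : Ω) :
    birkhoffSum T (fun y => h y - a) n x = birkhoffSum T h n x - n * a := by
  simp [birkhoffSum, Finset.sum_sub_distrib]

variable [MeasurableSpace Ω]

theorem measurable_birkhoffSum {M : Type*} [AddCommMonoid M] [MeasurableSpace M]
    [MeasurableAdd₂ M] {g : Ω → M} (hT : Measurable T) (hg : Measurable g) (n : ℕ) :
    Measurable (birkhoffSum T g n) :=
  Finset.measurable_fun_sum _ fun i _ => hg.comp (hT.iterate i)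

theorem measurableSet_unboundedSums (hT : Measurable T) (hg : Measurable g) :
    MeasurableSet (unboundedSums T g) := by
  have : unboundedSums T g = ⋂ K : ℕ, ⋃ n, {x | (K : ℝ) < birkhoffSum T g n x} := by
    ext x; simp [unboundedSums]
  rw [this]
  exact MeasurableSet.iInter fun K => MeasurableSet.iUnion fun n =>
    measurableSet_lt measurable_const (measurable_birkhoffSum hT hg n)

theorem measurable_maxSum (hT : Measurable T) (hg : Measurable g) (n : ℕ) :
    Measurable (maxSum T g n) := by
  induction n with
  | zero => exact measurable_const
  | succ n ih => exact measurable_const.max (hg.add (ih.comp hT))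

variable {m : Measure Ω}

theorem integrable_maxSum (hT : MeasurePreserving T m m) (hg : Integrable g m) (n : ℕ) :
    Integrable (maxSum T g n) m := by
  induction n with
  | zero => exact integrable_zero _ _ _
  | succ n ih =>
    exact (integrable_zero Ω ℝ m).sup (hg.add (hT.integrable_comp_of_integrable ih))

theorem setIntegral_maxSum_pos_nonneg (hT : MeasurePreserving T m m) (hgm : Measurable g)
    (hg : Integrable g m) (n : ℕ) : 0 ≤ ∫ x in {x | 0 < maxSum T g n x}, g x ∂m := by
  cases n with
  | zero => simp [maxSum]
  | succ n =>
    set E := {x | 0 < maxSum T g (n + 1) x}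
    have hE : MeasurableSet E :=
      measurableSet_lt measurable_const (measurable_maxSum hT.measurable hgm _)
    have hI := integrable_maxSum hT hg n
    have hI1 := integrable_maxSum hT hg (n + 1)
    have hIT : Integrable (fun x => maxSum T g n (T x)) m := hT.integrable_comp_of_integrable hI
    have hgE : ∫ x in E, g x ∂m = ∫ x in E, (maxSum T g (n + 1) x - maxSum T g n (T x)) ∂m := by
      refine setIntegral_congr_fun hE fun x hx => ?_
      have hx' : 0 < max 0 (g x + maxSum T g n (T x)) := hx
      have : maxSum T g (n + 1) x = g x + maxSum T g n (T x) :=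
        max_eq_right (by
          rcases lt_max_iff.1 hx' with h | h
          · exact absurd h (lt_irrefl _)
          · exact h.le)
      simp only [this]; ring
    rw [hgE, integral_sub hI1.integrableOn hIT.integrableOn]
    have h1 : ∫ x in E, maxSum T g (n + 1) x ∂m = ∫ x, maxSum T g (n + 1) x ∂m :=
      setIntegral_eq_integral_of_forall_compl_eq_zero fun x hx =>
        le_antisymm (not_lt.1 hx) (maxSum_nonneg _ _)
    have h2 : ∫ x in E, maxSum T g n (T x) ∂m ≤ ∫ x, maxSum T g n (T x) ∂m :=
      setIntegral_le_integral hIT (Eventually.of_forall fun x => maxSum_nonneg _ _)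
    have h3 : ∫ x, maxSum T g n (T x) ∂m = ∫ x, maxSum T g n x ∂m := by
      conv_rhs => rw [← hT.map_eq]
      rw [integral_map hT.aemeasurable
        (measurable_maxSum hT.measurable hgm n).aestronglyMeasurable]
    have h4 : ∫ x, maxSum T g n x ∂m ≤ ∫ x, maxSum T g (n + 1) x ∂m :=
      integral_mono hI hI1 (maxSum_le_succ n)
    linarith

/-- The maximal ergodic theorem on an invariant set. -/
theorem setIntegral_nonneg_of_exists_birkhoffSum_pos (hT : MeasurePreserving T m m)
    (hgm : Measurable g) {C : Set Ω} (hC : MeasurableSet C) (hinv : T ⁻¹' C = C)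
    (hg : IntegrableOn g C m) (hpos : ∀ x ∈ C, ∃ n, 0 < birkhoffSum T g n x) :
    0 ≤ ∫ x in C, g x ∂m := by
  set g' := C.indicator g with hg'
  have hiter : ∀ i, ∀ x ∈ C, T^[i] x ∈ C := by
    intro i
    induction i with
    | zero => exact fun x hx => hx
    | succ i ih => exact fun x hx => ih (T x) (by rw [← hinv] at hx; exact hx)
  have hsum : ∀ x ∈ C, ∀ n, birkhoffSum T g' n x = birkhoffSum T g n x := fun x hx n =>
    Finset.sum_congr rfl fun i _ => Set.indicator_of_mem (hiter i x hx) g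
  have hzero : ∀ x ∉ C, g' x = 0 := fun x hx => Set.indicator_of_notMem hx g
  have hU : ⋃ n, {x | 0 < maxSum T g' n x} = C := by
    refine Set.Subset.antisymm (Set.iUnion_subset fun n x hx => ?_) fun x hx => ?_
    · by_contra h
      exact (ne_of_gt hx) (maxSum_eq_zero_of_notMem hinv hzero n x h)
    · obtain ⟨n, hn⟩ := hpos x hx
      exact Set.mem_iUnion.2
        ⟨n, (by rwa [hsum x hx n] : 0 < birkhoffSum T g' n x).trans_le (birkhoffSum_le_maxSum n x)⟩
  have hgm' : Measurable g' := hgm.indicator hC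
  have hgi : Integrable g' m := (integrable_indicator_iff hC).2 hg
  have hlim := tendsto_setIntegral_of_monotone (μ := m) (f := g')
    (s := fun n => {x | 0 < maxSum T g' n x})
    (fun n => measurableSet_lt measurable_const (measurable_maxSum hT.measurable hgm' _))
    (monotone_nat_of_le_succ fun n x hx => lt_of_lt_of_le hx (maxSum_le_succ n x))
    hgi.integrableOn
  rw [hU, setIntegral_indicator hC, Set.inter_self] at hlim
  exact ge_of_tendsto' hlim fun n => setIntegral_maxSum_pos_nonneg hT hgm' hgi n

theorem measure_unboundedSums_inter_eq_zero [IsFiniteMeasure m] (hT : MeasurePreserving T m m)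
    {h : Ω → ℝ} (hm : Measurable h) (h0 : ∀ x, 0 ≤ h x) {a b : ℝ} (hab : a < b) :
    m (unboundedSums T (fun x => a - h x) ∩ unboundedSums T (fun x => h x - b)) = 0 := by
  set C := unboundedSums T (fun x => a - h x) ∩ unboundedSums T (fun x => h x - b) with hCdef
  have hC : MeasurableSet C :=
    (measurableSet_unboundedSums hT.measurable (measurable_const.sub hm)).inter
      (measurableSet_unboundedSums hT.measurable (hm.sub measurable_const))
  have hinv : T ⁻¹' C = C := by
    rw [hCdef, Set.preimage_inter, preimage_unboundedSums, preimage_unboundedSums]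
  have htrunc : ∀ M : ℕ, Integrable (fun x => min (h x) M) m := fun M =>
    Integrable.of_bound (hm.min measurable_const).aestronglyMeasurable (M : ℝ)
      (Eventually.of_forall fun x => by
        rw [Real.norm_of_nonneg (le_min (h0 x) (by positivity))]; exact min_le_right _ _)
  have hbound : ∀ M : ℕ, ∫ x in C, min (h x) M ∂m ≤ m.real C * a := by
    intro M
    have := setIntegral_nonneg_of_exists_birkhoffSum_pos (g := fun x => a - min (h x) M) hT
      (measurable_const.sub (hm.min measurable_const)) hC hinv
      ((integrable_const a).sub (htrunc M)).integrableOn fun x hx => by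
        obtain ⟨n, hn⟩ := hx.1 0
        refine ⟨n, ?_⟩
        rw [birkhoffSum_const_sub] at hn ⊢
        have : birkhoffSum T (fun y => min (h y) M) n x ≤ birkhoffSum T h n x :=
          Finset.sum_le_sum fun i _ => min_le_left _ _
        push_cast at hn
        linarith
    rw [integral_sub (integrable_const a).integrableOn (htrunc M).integrableOn,
      setIntegral_const, smul_eq_mul] at this
    linarith
  have hlint : ∫⁻ x in C, ENNReal.ofReal (h x) ∂m ≤ ENNReal.ofReal (m.real C * a) := by
    have hl : Tendsto (fun M : ℕ => ∫⁻ x in C, ENNReal.ofReal (min (h x) M) ∂m) atTop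
        (𝓝 (∫⁻ x in C, ENNReal.ofReal (h x) ∂m)) := by
      refine lintegral_tendsto_of_tendsto_of_monotone
        (fun M => (hm.min measurable_const).ennreal_ofReal.aemeasurable)
        (Eventually.of_forall fun x M N hMN => ENNReal.ofReal_le_ofReal
          (min_le_min le_rfl (by exact_mod_cast hMN)))
        (Eventually.of_forall fun x => ?_)
      obtain ⟨N, hN⟩ := exists_nat_ge (h x)
      refine tendsto_const_nhds.congr' ((eventually_ge_atTop N).mono fun M hM => ?_)
      have : h x ≤ (M : ℝ) := hN.trans (by exact_mod_cast hM)
      simp only [min_eq_left this]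
    refine le_of_tendsto' hl fun M => ?_
    rw [← ofReal_integral_eq_lintegral_ofReal (htrunc M).integrableOn
      (Eventually.of_forall fun x => le_min (h0 x) (by positivity))]
    exact ENNReal.ofReal_le_ofReal (hbound M)
  have hint : IntegrableOn h C m :=
    ⟨hm.aestronglyMeasurable, by
      rw [hasFiniteIntegral_iff_ofReal (Eventually.of_forall h0)]
      exact hlint.trans_lt ENNReal.ofReal_lt_top⟩
  have hle : ∫ x in C, h x ∂m ≤ m.real C * a := by
    have hnn : 0 ≤ m.real C * a := le_trans
      (integral_nonneg fun x => le_min (h0 x) (by positivity)) (hbound 0)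
    rw [integral_eq_lintegral_of_nonneg_ae (Eventually.of_forall h0) hm.aestronglyMeasurable]
    exact ENNReal.toReal_le_of_le_ofReal hnn hlint
  have hge := setIntegral_nonneg_of_exists_birkhoffSum_pos (g := fun x => h x - b) hT
    (hm.sub measurable_const) hC hinv (hint.sub (integrable_const b).integrableOn)
    fun x hx => by obtain ⟨n, hn⟩ := hx.2 0; exact ⟨n, by simpa using hn⟩
  rw [integral_sub hint (integrable_const b).integrableOn, setIntegral_const, smul_eq_mul] at hge
  have hreal : m.real C = 0 := by
    have h1 : 0 ≤ m.real C := measureReal_nonneg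
    nlinarith
  exact (measureReal_eq_zero_iff).1 hreal

/-- Pointwise ergodic theorem (existence of the limit) for nonnegative finite functions. -/
theorem ae_exists_tendsto_birkhoffSum_div [IsFiniteMeasure m] (hT : MeasurePreserving T m m)
    {h : Ω → ℝ≥0∞} (hm : Measurable h) (hfin : ∀ x, h x ≠ ∞) :
    ∀ᵐ x ∂m, ∃ a, Tendsto (fun n : ℕ => birkhoffSum T h n x / (n : ℝ≥0∞)) atTop (𝓝 a) := by
  have hall : ∀ᵐ x ∂m, ∀ p q : ℚ, p < q →
      x ∉ unboundedSums T (fun x => p - (h x).toReal) ∩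
        unboundedSums T (fun x => (h x).toReal - q) := by
    refine ae_all_iff.2 fun p => ae_all_iff.2 fun q => ?_
    by_cases hpq : p < q
    · filter_upwards [measure_eq_zero_iff_ae_notMem.1
        (measure_unboundedSums_inter_eq_zero hT hm.ennreal_toReal
          (fun x => ENNReal.toReal_nonneg) (by exact_mod_cast hpq : (p : ℝ) < q))] with x hx _
      exact hx
    · exact Eventually.of_forall fun x h => absurd h hpq
  filter_upwards [hall] with x hx
  have hS : ∀ n, birkhoffSum T h n x =
      ENNReal.ofReal (birkhoffSum T (fun y => (h y).toReal) n x) := by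
    intro n
    rw [birkhoffSum, birkhoffSum, ENNReal.ofReal_sum_of_nonneg fun _ _ => ENNReal.toReal_nonneg]
    exact Finset.sum_congr rfl fun i _ => (ENNReal.ofReal_toReal (hfin _)).symm
  set S := fun n => birkhoffSum T (fun y => (h y).toReal) n x
  have hS0 : ∀ n, 0 ≤ S n := fun n => Finset.sum_nonneg fun _ _ => ENNReal.toReal_nonneg
  have hdiv : ∀ n : ℕ, 1 ≤ n → birkhoffSum T h n x / (n : ℝ≥0∞) = ENNReal.ofReal (S n / n) := by
    intro n hn
    rw [hS, ENNReal.ofReal_div_of_pos (by exact_mod_cast hn), ENNReal.ofReal_natCast]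
  refine tendsto_of_no_upcrossings dense_univ fun a _ b _ hab => ?_
  rintro ⟨hfa, hfb⟩
  obtain ⟨p, hp0, hap, hpb⟩ := ENNReal.lt_iff_exists_rat_btwn.1 hab
  obtain ⟨q, hq0, hpq, hqb⟩ := ENNReal.lt_iff_exists_rat_btwn.1 hpb
  obtain ⟨p', hp'0, hap', hp'p⟩ := ENNReal.lt_iff_exists_rat_btwn.1 hap
  obtain ⟨q', hq'0, hqq', hq'b⟩ := ENNReal.lt_iff_exists_rat_btwn.1 hqb
  have hreal : ∀ {r s : ℚ}, 0 ≤ s →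
      ((Real.toNNReal r : NNReal) : ℝ≥0∞) < (Real.toNNReal s : NNReal) → r < s := by
    intro r s hs hrs
    have := (Real.toNNReal_lt_toNNReal_iff' ).1 (ENNReal.coe_lt_coe.1 hrs)
    exact_mod_cast this.1
  have hpq' := hreal hq0 hpq
  have hpp' := hreal hp0 hp'p
  have hqq'' := hreal hq'0 hqq'
  refine hx p q hpq' ⟨fun K => ?_, fun K => ?_⟩
  · obtain ⟨N, hN⟩ := exists_nat_gt ((K : ℝ) / (p - p'))
    obtain ⟨n, hn, hna⟩ := (frequently_atTop.1 hfa) (N + 1)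
    refine ⟨n, ?_⟩
    rw [birkhoffSum_const_sub]
    rw [hdiv n (by omega)] at hna
    have hn0 : (0 : ℝ) < n := by exact_mod_cast (by omega : 0 < n)
    have hlt : S n / n < p' := by
      have := hna.trans hap'
      exact (ENNReal.ofReal_lt_ofReal_iff_of_nonneg (by have := hS0 n; positivity)).1 this
    rw [div_lt_iff₀ hn0] at hlt
    have hd : (0 : ℝ) < p - p' := by exact_mod_cast sub_pos.2 hpp'
    rw [div_lt_iff₀ hd] at hN
    have : (N : ℝ) * (p - p') ≤ n * (p - p') := by
      gcongr; omega
    change (K : ℝ) < n * p - S n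
    linarith
  · obtain ⟨N, hN⟩ := exists_nat_gt ((K : ℝ) / (q' - q))
    obtain ⟨n, hn, hnb⟩ := (frequently_atTop.1 hfb) (N + 1)
    refine ⟨n, ?_⟩
    rw [birkhoffSum_sub_const]
    rw [hdiv n (by omega)] at hnb
    have hn0 : (0 : ℝ) < n := by exact_mod_cast (by omega : 0 < n)
    have hlt : q' < S n / n := by
      have := hq'b.trans hnb
      exact (ENNReal.ofReal_lt_ofReal_iff_of_nonneg (by exact_mod_cast hq'0)).1 this
    rw [lt_div_iff₀ hn0] at hlt
    have hd : (0 : ℝ) < q' - q := by exact_mod_cast sub_pos.2 hqq''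
    rw [div_lt_iff₀ hd] at hN
    have : (N : ℝ) * (q' - q) ≤ n * (q' - q) := by
      gcongr; omega
    change (K : ℝ) < S n - n * q
    linarith

end Birkhoff

section Averages

theorem tendsto_succ_div_nat :
    Tendsto (fun n : ℕ => ((n + 1 : ℕ) : ℝ≥0∞) / (n : ℝ≥0∞)) atTop (𝓝 1) := by
  have h : Tendsto (fun n : ℕ => 1 + (n : ℝ≥0∞)⁻¹) atTop (𝓝 (1 + 0)) :=
    tendsto_const_nhds.add ENNReal.tendsto_inv_nat_nhds_zero
  rw [add_zero] at h
  refine h.congr' ((eventually_ge_atTop 1).mono fun n hn => ?_)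
  have hn0 : (n : ℝ≥0∞) ≠ 0 := by exact_mod_cast (by omega : n ≠ 0)
  push_cast
  rw [ENNReal.add_div, ENNReal.div_self hn0 (ENNReal.natCast_ne_top n), one_div]

theorem tendsto_average_succ_iff {c : ℕ → ℝ≥0∞} (h0 : c 0 ≠ ∞) {a : ℝ≥0∞} :
    Tendsto (fun n : ℕ => (∑ i ∈ Finset.range n, c (i + 1)) / (n : ℝ≥0∞)) atTop (𝓝 a) ↔
      Tendsto (fun n : ℕ => (∑ i ∈ Finset.range n, c i) / (n : ℝ≥0∞)) atTop (𝓝 a) := by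
  have hc : Tendsto (fun n : ℕ => c 0 / (n : ℝ≥0∞)) atTop (𝓝 0) := by
    have := ENNReal.Tendsto.const_mul (a := c 0) ENNReal.tendsto_inv_nat_nhds_zero (Or.inr h0)
    simpa [div_eq_mul_inv] using this
  have hsucc : ∀ n : ℕ, ∑ i ∈ Finset.range (n + 1), c i =
      ∑ i ∈ Finset.range n, c (i + 1) + c 0 := fun n => Finset.sum_range_succ' c n
  constructor
  · intro h
    rw [← tendsto_add_atTop_iff_nat 1]
    have h1 := ENNReal.Tendsto.mul (h.add hc) (Or.inr (by simp)) tendsto_succ_div_nat.inv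
      (Or.inl (by simp))
    rw [add_zero, inv_one, mul_one] at h1
    refine h1.congr' ((eventually_ge_atTop 1).mono fun n hn => ?_)
    have hn0 : (n : ℝ≥0∞) ≠ 0 := by exact_mod_cast (by omega : n ≠ 0)
    dsimp only
    rw [hsucc, ← ENNReal.add_div, ENNReal.inv_div (Or.inl (ENNReal.natCast_ne_top n)) (Or.inl hn0),
      div_eq_mul_inv, div_eq_mul_inv, div_eq_mul_inv, mul_assoc, ← mul_assoc (n : ℝ≥0∞)⁻¹,
      ENNReal.inv_mul_cancel hn0 (ENNReal.natCast_ne_top n), one_mul]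
  · intro h
    have h1 := ENNReal.Tendsto.sub (ENNReal.Tendsto.mul ((tendsto_add_atTop_iff_nat 1).2 h)
      (Or.inr (by simp)) tendsto_succ_div_nat (Or.inl (by simp))) hc (Or.inr (by simp))
    rw [tsub_zero, mul_one] at h1
    refine h1.congr' ((eventually_ge_atTop 1).mono fun n hn => ?_)
    have hn0 : (n : ℝ≥0∞) ≠ 0 := by exact_mod_cast (by omega : n ≠ 0)
    have hn1 : ((n + 1 : ℕ) : ℝ≥0∞) ≠ 0 := by exact_mod_cast n.succ_ne_zero
    dsimp only
    rw [hsucc, div_eq_mul_inv, div_eq_mul_inv, div_eq_mul_inv, mul_assoc,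
      ← mul_assoc ((n + 1 : ℕ) : ℝ≥0∞)⁻¹,
      ENNReal.inv_mul_cancel hn1 (ENNReal.natCast_ne_top _), one_mul, ← div_eq_mul_inv,
      ← div_eq_mul_inv, ENNReal.add_div, ENNReal.add_sub_cancel_right]
    exact ENNReal.div_ne_top h0 hn0

theorem limUnder_average_succ {c : ℕ → ℝ≥0∞} (h0 : c 0 ≠ ∞) :
    limUnder atTop (fun n : ℕ => (∑ i ∈ Finset.range n, c (i + 1)) / (n : ℝ≥0∞)) =
      limUnder atTop (fun n : ℕ => (∑ i ∈ Finset.range n, c i) / (n : ℝ≥0∞)) := by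
  unfold limUnder lim
  congr 1
  funext a
  exact propext (tendsto_average_succ_iff h0)

end Averages

theorem iterate_shift_preimage_of_invariant {α : Type*} {A : Set (ℤ → α)}
    (hA : shift ⁻¹' A = A) (i : ℕ) :
    shift^[i] ⁻¹' A = A := by
  induction i with
  | zero => rfl
  | succ i ih => rw [Function.iterate_succ, Set.preimage_comp, ih, hA]

section Stationary

variable {α : Type*} [MeasurableSpace α] {μ m : Measure (ℤ → α)}

theorem measurable_shift : Measurable (shift : (ℤ → α) → ℤ → α) :=
  measurable_pi_lambda _ fun i => measurable_pi_apply (i + 1)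

theorem cesaro_of_invariant {A : Set (ℤ → α)} (hA : shift ⁻¹' A = A) {n : ℕ} (hn : 1 ≤ n) :
    cesaro μ A n = μ A := by
  have hn0 : (n : ℝ≥0∞) ≠ 0 := by exact_mod_cast (by omega : n ≠ 0)
  simp only [cesaro, iterate_shift_preimage_of_invariant hA, Finset.sum_const, Finset.card_range,
    nsmul_eq_mul]
  rw [mul_comm, mul_div_assoc, ENNReal.div_self hn0 (ENNReal.natCast_ne_top n), mul_one]

theorem cesaro_le_one [IsProbabilityMeasure μ] (A : Set (ℤ → α)) (n : ℕ) : cesaro μ A n ≤ 1 := by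
  refine ENNReal.div_le_of_le_mul ?_
  rw [one_mul]
  calc ∑ i ∈ Finset.range n, μ (shift^[i] ⁻¹' A) ≤ ∑ i ∈ Finset.range n, 1 :=
        Finset.sum_le_sum fun i _ => prob_le_one
    _ = n := by simp

theorem IsAMS.exists_isStationaryMean [IsProbabilityMeasure μ] (h : IsAMS μ) :
    ∃ m, IsStationaryMean μ m := by
  classical
  let a : Set (ℤ → α) → ℝ≥0∞ := fun A => if hA : MeasurableSet A then (h A hA).choose else 0
  have ha : ∀ A, MeasurableSet A → Tendsto (cesaro μ A) atTop (𝓝 (a A)) := fun A hA => by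
    simp only [a, dif_pos hA]; exact (h A hA).choose_spec
  let P : ℕ → Measure (ℤ → α) := fun n =>
    ((n + 1 : ℕ) : ℝ≥0∞)⁻¹ • ∑ i ∈ Finset.range (n + 1), μ.map shift^[i]
  have hP : ∀ n A, MeasurableSet A → P n A = cesaro μ A (n + 1) := fun n A hA => by
    simp only [P, cesaro, Measure.smul_apply, Measure.finsetSum_apply, smul_eq_mul,
      div_eq_mul_inv]
    rw [mul_comm]
    congr 1
    exact Finset.sum_congr rfl fun i _ => Measure.map_apply (measurable_shift.iterate i) hA
  have : ∀ n, IsFiniteMeasure (P n) := fun n =>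
    ⟨by rw [hP n _ MeasurableSet.univ]; exact (cesaro_le_one _ _).trans_lt ENNReal.one_lt_top⟩
  obtain ⟨M, hM⟩ := exists_measure_of_setwise_tendsto P a
    (fun A hA => ((tendsto_add_atTop_iff_nat 1).2 (ha A hA)).congr fun n => (hP n A hA).symm)
    fun A hA => ((le_of_tendsto' (ha A hA) (cesaro_le_one A)).trans_lt ENNReal.one_lt_top).ne
  exact ⟨M, fun A hA => by rw [hM A hA]; exact ha A hA⟩

namespace IsStationaryMean

theorem measure_eq_of_invariant (h : IsStationaryMean μ m) {A : Set (ℤ → α)}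
    (hA : MeasurableSet A) (hinv : shift ⁻¹' A = A) : m A = μ A :=
  tendsto_nhds_unique (h A hA) (tendsto_const_nhds.congr'
    ((eventually_ge_atTop 1).mono fun _ hn => (cesaro_of_invariant hinv hn).symm))

theorem isProbabilityMeasure [IsProbabilityMeasure μ] (h : IsStationaryMean μ m) :
    IsProbabilityMeasure m :=
  ⟨by rw [h.measure_eq_of_invariant MeasurableSet.univ Set.preimage_univ, measure_univ]⟩

theorem measurePreserving [IsFiniteMeasure μ] (h : IsStationaryMean μ m) :
    MeasurePreserving shift m m := by
  refine ⟨measurable_shift, Measure.ext fun A hA => ?_⟩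
  rw [Measure.map_apply measurable_shift hA]
  refine tendsto_nhds_unique (h _ (measurable_shift hA)) ?_
  have := (tendsto_average_succ_iff (c := fun i => μ (shift^[i] ⁻¹' A)) (measure_ne_top _ _)).2
    (h A hA)
  refine this.congr fun n => ?_
  simp only [cesaro, Function.iterate_succ', Set.preimage_comp]

theorem lintegral_eq_of_invariant (h : IsStationaryMean μ m) {φ : (ℤ → α) → ℝ≥0∞}
    (hφ : Measurable φ) (hinv : ∀ x, φ (shift x) = φ x) : ∫⁻ x, φ x ∂m = ∫⁻ x, φ x ∂μ := by
  have hle := MeasurableSpace.invariants_le (shift : (ℤ → α) → ℤ → α)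
  have hφ' : Measurable[MeasurableSpace.invariants shift] φ :=
    MeasurableSpace.measurable_invariants_dom.2 ⟨hφ, fun s _ => by
      rw [show φ ∘ shift = φ from funext hinv]⟩
  rw [← lintegral_trim hle hφ', ← lintegral_trim hle hφ']
  congr 1
  refine @Measure.ext _ (MeasurableSpace.invariants shift) _ _ fun s hs => ?_
  rw [trim_measurableSet_eq hle hs, trim_measurableSet_eq hle hs]
  exact h.measure_eq_of_invariant hs.1 hs.2

theorem ae_iff_of_invariant (h : IsStationaryMean μ m) {p : (ℤ → α) → Prop}
    (hp : MeasurableSet {x | p x}) (hinv : ∀ x, p (shift x) ↔ p x) :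
    (∀ᵐ x ∂m, p x) ↔ ∀ᵐ x ∂μ, p x := by
  rw [ae_iff, ae_iff, ← Set.compl_ofPred, h.measure_eq_of_invariant hp.compl]
  ext x
  exact not_congr (hinv x)

/-- Averages of a finite nonnegative function converge almost everywhere for the stationary mean
and for the measure itself. -/
theorem ae_exists_tendsto_average [IsProbabilityMeasure μ] (h : IsStationaryMean μ m)
    {φ : (ℤ → α) → ℝ≥0∞} (hφ : Measurable φ) (hfin : ∀ x, φ x ≠ ∞) :
    (∀ᵐ x ∂m, ∃ a, Tendsto (fun n : ℕ => (∑ i ∈ Finset.range n, φ (shift^[i] x)) / (n : ℝ≥0∞))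
      atTop (𝓝 a)) ∧
    ∀ᵐ x ∂μ, ∃ a, Tendsto (fun n : ℕ => (∑ i ∈ Finset.range n, φ (shift^[i] x)) / (n : ℝ≥0∞))
      atTop (𝓝 a) := by
  have := h.isProbabilityMeasure
  have h1 := ae_exists_tendsto_birkhoffSum_div h.measurePreserving hφ hfin
  refine ⟨h1, (h.ae_iff_of_invariant ?_ fun x => exists_congr fun a =>
    tendsto_average_succ_iff (c := fun i => φ (shift^[i] x)) (hfin _)).1 h1⟩
  exact measurableSet_exists_tendsto fun n => (Finset.measurable_fun_sum _ fun i _ =>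
    hφ.comp (measurable_shift.iterate i)).div_const _

end IsStationaryMean

end Stationary

section Blocks

variable {X Y : Type*} {f : X → List Y} {x : ℤ → X}

theorem iterate_shift_apply {α : Type*} (n : ℕ) (x : ℤ → α) (i : ℤ) :
    shift^[n] x i = x (i + n) := by
  induction n generalizing x with
  | zero => simp
  | succ n ih =>
    rw [Function.iterate_succ_apply, ih]
    simp only [shift]
    congr 1
    push_cast
    ring

theorem block_zero (k : ℤ) : block f x k 0 = [] := rfl

theorem block_succ (k : ℤ) (n : ℕ) : block f x k (n + 1) = block f x k n ++ f (x (k + n)) := by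
  simp [block, List.range_succ]

theorem block_shift (k : ℤ) (n : ℕ) : block f (shift x) k n = block f x (k + 1) n := by
  induction n with
  | zero => rfl
  | succ n ih =>
    rw [block_succ, block_succ, ih]
    simp only [shift]
    rw [add_right_comm]

theorem block_add (k : ℤ) (n d : ℕ) :
    block f x k (n + d) = block f x k n ++ block f x (k + n) d := by
  induction d with
  | zero => simp [block_zero]
  | succ d ih =>
    rw [← add_assoc, block_succ, ih, block_succ, List.append_assoc]
    push_cast
    rw [add_assoc]

theorem block_one (k : ℤ) : block f x k 1 = f (x k) := by simp [block_succ, block_zero]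

theorem block_succ' (k : ℤ) (n : ℕ) : block f x k (n + 1) = f (x k) ++ block f x (k + 1) n := by
  rw [add_comm n 1, block_add, block_one]
  simp

theorem block_congr {x' : ℤ → X} {k : ℤ} {n : ℕ} (h : ∀ i : ℕ, i < n → x (k + i) = x' (k + i)) :
    block f x k n = block f x' k n := by
  induction n with
  | zero => rfl
  | succ n ih =>
    rw [block_succ, block_succ, ih fun i hi => h i (by omega), h n (by omega)]

theorem length_block_one_eq_totalLength (n : ℕ) :
    (block f x 1 n).length = totalLength f x n := by
  induction n with
  | zero => rfl
  | succ n ih =>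
    rw [block_succ, List.length_append, ih, totalLength, totalLength, Finset.sum_range_succ,
      add_comm (1 : ℤ)]

theorem getElem?_block_of_le {n n' k : ℕ} {y : Y} (h : (block f x 1 n)[k]? = some y)
    (hn : n ≤ n') : (block f x 1 n')[k]? = some y := by
  obtain ⟨d, rfl⟩ := Nat.exists_eq_add_of_le hn
  rw [block_add, List.getElem?_append_left (List.getElem?_eq_some_iff.1 h).1, h]

theorem getElem?_reverse_block_of_le {m m' k : ℕ} {y : Y}
    (h : (block f x (1 - m) m).reverse[k]? = some y) (hm : m ≤ m') :
    (block f x (1 - m') m').reverse[k]? = some y := by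
  obtain ⟨d, rfl⟩ := Nat.exists_eq_add_of_le hm
  rw [show block f x (1 - ((m + d : ℕ) : ℤ)) (m + d) =
      block f x (1 - ((m + d : ℕ) : ℤ)) d ++ block f x (1 - m) m by
    rw [add_comm m d, block_add]; congr 2; push_cast; ring,
    List.reverse_append, List.getElem?_append_left (List.getElem?_eq_some_iff.1 h).1, h]

theorem exists_getElem?_block_eq_code (z : codeDomain f) {j : ℤ} (hj : 1 ≤ j) :
    ∃ n, (block f z.1 1 n)[(j - 1).toNat]? = some (code f z j) := by
  refine ⟨Nat.find (z.2.1 (j - 1).toNat), ?_⟩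
  rw [code, if_pos hj]
  exact List.getElem?_eq_getElem _

theorem exists_getElem?_reverse_block_eq_code (z : codeDomain f) {j : ℤ} (hj : ¬ 1 ≤ j) :
    ∃ m : ℕ, (block f z.1 (1 - m) m).reverse[(-j).toNat]? = some (code f z j) := by
  refine ⟨Nat.find (z.2.2 (-j).toNat), ?_⟩
  rw [code, if_neg hj]
  exact List.getElem?_eq_getElem _

theorem code_eq_iff_of_pos (z : codeDomain f) {j : ℤ} (hj : 1 ≤ j) {y : Y} :
    code f z j = y ↔ ∃ n, (block f z.1 1 n)[(j - 1).toNat]? = some y := by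
  constructor
  · rintro rfl
    exact exists_getElem?_block_eq_code z hj
  · rintro ⟨n, hn⟩
    obtain ⟨n', hn'⟩ := exists_getElem?_block_eq_code z hj
    have h1 := getElem?_block_of_le hn (le_max_left n n')
    have h2 := getElem?_block_of_le hn' (le_max_right n n')
    exact Option.some.inj (h2.symm.trans h1)

theorem code_eq_iff_of_nonpos (z : codeDomain f) {j : ℤ} (hj : ¬ 1 ≤ j) {y : Y} :
    code f z j = y ↔ ∃ m : ℕ, (block f z.1 (1 - m) m).reverse[(-j).toNat]? = some y := by
  constructor
  · rintro rfl
    exact exists_getElem?_reverse_block_eq_code z hj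
  · rintro ⟨n, hn⟩
    obtain ⟨n', hn'⟩ := exists_getElem?_reverse_block_eq_code z hj
    have h1 := getElem?_reverse_block_of_le hn (le_max_left n n')
    have h2 := getElem?_reverse_block_of_le hn' (le_max_right n n')
    exact Option.some.inj (h2.symm.trans h1)

theorem shift_mem_codeDomain (hx : x ∈ codeDomain f) : shift x ∈ codeDomain f := by
  refine ⟨fun N => ?_, fun N => ?_⟩
  · obtain ⟨n, hn⟩ := hx.1 (N + (f (x 1)).length)
    rcases n with _ | n
    · simp [block_zero] at hn
    · refine ⟨n, ?_⟩
      rw [block_succ', List.length_append] at hn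
      rw [block_shift]
      omega
  · obtain ⟨m, hm⟩ := hx.2 N
    refine ⟨m + 1, ?_⟩
    rw [block_shift, show (1 - ((m + 1 : ℕ) : ℤ) + 1) = 1 - m by push_cast; ring, block_succ,
      List.length_append]
    omega

theorem code_shift (hx : x ∈ codeDomain f) (j : ℤ) :
    code f ⟨shift x, shift_mem_codeDomain hx⟩ j = code f ⟨x, hx⟩ (j + (f (x 1)).length) := by
  symm
  set L := (f (x 1)).length with hL
  by_cases hj : 1 ≤ j
  · obtain ⟨n, hn⟩ := exists_getElem?_block_eq_code ⟨shift x, shift_mem_codeDomain hx⟩ hj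
    refine (code_eq_iff_of_pos _ (by omega)).2 ⟨n + 1, ?_⟩
    rw [block_shift] at hn
    dsimp only
    rw [block_succ', List.getElem?_append_right (by omega), ← hn]
    congr 1
    omega
  · obtain ⟨m, hm⟩ := exists_getElem?_reverse_block_eq_code ⟨shift x, shift_mem_codeDomain hx⟩ hj
    rcases m with _ | m
    · simp [block_zero] at hm
    rw [block_shift, show (1 - ((m + 1 : ℕ) : ℤ) + 1) = 1 - m by push_cast; ring, block_succ,
      List.reverse_append, sub_add_cancel] at hm
    by_cases hjL : 1 ≤ j + L
    · refine (code_eq_iff_of_pos _ hjL).2 ⟨1, ?_⟩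
      rw [List.getElem?_append_left (by rw [List.length_reverse]; omega),
        List.getElem?_reverse (by omega)] at hm
      rw [block_one, ← hm]
      congr 1
      omega
    · refine (code_eq_iff_of_nonpos _ hjL).2 ⟨m, ?_⟩
      rw [List.getElem?_append_right (by rw [List.length_reverse]; omega)] at hm
      rw [← hm, List.length_reverse]
      congr 1
      omega

theorem totalLength_succ (n : ℕ) :
    totalLength f x (n + 1) = totalLength f x n + (f (shift^[n] x 1)).length := by
  rw [iterate_shift_apply, totalLength, totalLength, Finset.sum_range_succ, add_comm (1 : ℤ)]

theorem totalLength_eq_sum (n : ℕ) :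
    totalLength f x n = ∑ i ∈ Finset.range n, (f (shift^[i] x 1)).length := by
  induction n with
  | zero => rfl
  | succ n ih => rw [totalLength_succ, ih, Finset.sum_range_succ]

theorem iterate_shift_mem_codeDomain (hx : x ∈ codeDomain f) (i : ℕ) :
    shift^[i] x ∈ codeDomain f := by
  induction i with
  | zero => exact hx
  | succ i ih => rw [Function.iterate_succ_apply']; exact shift_mem_codeDomain ih

theorem code_iterate_shift (hx : x ∈ codeDomain f) (i : ℕ) :
    code f ⟨shift^[i] x, iterate_shift_mem_codeDomain hx i⟩ =
      shift^[totalLength f x i] (code f ⟨x, hx⟩) := by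
  induction i with
  | zero => rfl
  | succ i ih =>
    have h := iterate_shift_mem_codeDomain hx i
    have : code f ⟨shift (shift^[i] x), shift_mem_codeDomain h⟩ =
        shift^[(f (shift^[i] x 1)).length] (code f ⟨shift^[i] x, h⟩) := by
      funext j
      exact (code_shift h j).trans (iterate_shift_apply _ _ _).symm
    simp only [Function.iterate_succ_apply']
    rw [this, ih, totalLength_succ, add_comm, Function.iterate_add_apply]

/-- The sequences whose coded sequence belongs to `A`. -/
def codePreimage (f : X → List Y) (A : Set (ℤ → Y)) : Set (ℤ → X) :=
  {z | ∃ h : z ∈ codeDomain f, code f ⟨z, h⟩ ∈ A}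

theorem codePreimage_eq_image (A : Set (ℤ → Y)) :
    codePreimage f A = Subtype.val '' (code f ⁻¹' A) := by
  ext x
  simp [codePreimage]

theorem F_eq_indicator (A : Set (ℤ → Y)) (k : ℕ) :
    F f A k = (codePreimage f (shift^[k] ⁻¹' A)).indicator 1 := rfl

theorem F_le_one (A : Set (ℤ → Y)) (k : ℕ) (x : ℤ → X) : F f A k x ≤ 1 := by
  rw [F_eq_indicator]
  exact Set.indicator_le_self' (fun _ _ => zero_le) x

theorem G_ne_top (A : Set (ℤ → Y)) (x : ℤ → X) : G f A x ≠ ∞ :=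
  ENNReal.sum_ne_top.2 fun k _ => ((F_le_one A k x).trans_lt ENNReal.one_lt_top).ne

theorem F_iterate_shift (hx : x ∈ codeDomain f) (A : Set (ℤ → Y)) (k i : ℕ) :
    F f A k (shift^[i] x) = F f A (totalLength f x i + k) x := by
  have hi := iterate_shift_mem_codeDomain hx i
  have : shift^[i] x ∈ codePreimage f (shift^[k] ⁻¹' A) ↔
      x ∈ codePreimage f (shift^[totalLength f x i + k] ⁻¹' A) := by
    simp only [codePreimage, Set.mem_ofPred_eq, hi, hx, exists_true_left, Set.mem_preimage,
      code_iterate_shift hx i]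
    rw [add_comm, Function.iterate_add_apply]
  rw [F_eq_indicator, F_eq_indicator]
  by_cases hA : shift^[i] x ∈ codePreimage f (shift^[k] ⁻¹' A)
  · rw [Set.indicator_of_mem hA, Set.indicator_of_mem (this.1 hA)]; rfl
  · rw [Set.indicator_of_notMem hA, Set.indicator_of_notMem fun h => hA (this.2 h)]

theorem sum_G_eq_sum_F (hx : x ∈ codeDomain f) (A : Set (ℤ → Y)) (n : ℕ) :
    ∑ i ∈ Finset.range n, G f A (shift^[i] x) =
      ∑ k ∈ Finset.range (totalLength f x n), F f A k x := by
  induction n with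
  | zero => rfl
  | succ n ih =>
    rw [Finset.sum_range_succ, ih, totalLength_succ, Finset.sum_range_add]
    congr 1
    exact Finset.sum_congr rfl fun k _ => F_iterate_shift hx A k n

theorem exists_lt_length_block_left (hne : ∃ i, f (x i) ≠ [])
    (h : ∀ i, f (x i) ≠ [] → ∃ j < i, f (x j) ≠ []) (N : ℕ) :
    ∃ m : ℕ, N < (block f x (1 - m) m).length := by
  have hfar : ∀ B : ℤ, ∃ j ≤ B, f (x j) ≠ [] := by
    obtain ⟨i, hi⟩ := hne
    have : ∀ n : ℕ, ∃ j ≤ i - n, f (x j) ≠ [] := by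
      intro n
      induction n with
      | zero => exact ⟨i, by simp, hi⟩
      | succ n ih =>
        obtain ⟨j, hj, hj'⟩ := ih
        obtain ⟨l, hl, hl'⟩ := h j hj'
        exact ⟨l, by push_cast; omega, hl'⟩
    intro B
    obtain ⟨j, hj, hj'⟩ := this (i - B).toNat
    exact ⟨j, by omega, hj'⟩
  have key : ∀ m : ℕ, ∃ m' : ℕ,
      (block f x (1 - m) m).length < (block f x (1 - m') m').length := by
    intro m
    obtain ⟨j, hj, hne⟩ := hfar (-m)
    obtain ⟨d, hd⟩ : ∃ d : ℕ, j = 1 - ((d + 1 + m : ℕ) : ℤ) :=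
      ⟨(-m - j).toNat, by push_cast; omega⟩
    refine ⟨d + 1 + m, ?_⟩
    have e : (1 - ((d + 1 + m : ℕ) : ℤ)) + ((d + 1 : ℕ) : ℤ) = 1 - m := by push_cast; ring
    rw [block_add, e, block_succ', ← hd, List.length_append, List.length_append]
    have := List.length_pos_iff.2 hne
    omega
  induction N with
  | zero =>
    obtain ⟨m', hm'⟩ := key 0
    exact ⟨m', by omega⟩
  | succ N ih =>
    obtain ⟨m, hm⟩ := ih
    obtain ⟨m', hm'⟩ := key m
    exact ⟨m', by omega⟩

end Blocks

section Measurability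

theorem measurableSet_apply {X : Type*} [MeasurableSpace X] [DiscreteMeasurableSpace X]
    (p : X → Prop) (i : ℤ) : MeasurableSet {x : ℤ → X | p (x i)} :=
  measurable_pi_apply i (MeasurableSet.of_discrete (s := {c | p c}))

variable {X Y : Type*} [Countable X] [MeasurableSpace X] [DiscreteMeasurableSpace X]
  {f : X → List Y}

theorem measurableSet_block (p : List Y → Prop) (k : ℤ) (n : ℕ) :
    MeasurableSet {x : ℤ → X | p (block f x k n)} := by
  have hψ : Measurable fun (x : ℤ → X) (i : Fin n) => x (k + i) :=
    measurable_pi_lambda _ fun i => measurable_pi_apply _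
  have hB : MeasurableSet {v : Fin n → X |
      ∃ x : ℤ → X, (∀ i : Fin n, x (k + i) = v i) ∧ p (block f x k n)} :=
    (Set.to_countable _).measurableSet
  convert hψ hB using 1
  ext x
  refine ⟨fun hx => ⟨x, fun _ => rfl, hx⟩, ?_⟩
  rintro ⟨x', hx', hp⟩
  rwa [block_congr fun i hi => hx' ⟨i, hi⟩] at hp

theorem measurableSet_codeDomain : MeasurableSet (codeDomain f) := by
  have : codeDomain f = (⋂ N : ℕ, ⋃ n : ℕ, {x | N < (block f x 1 n).length}) ∩
      ⋂ N : ℕ, ⋃ m : ℕ, {x | N < (block f x (1 - m) m).length} := by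
    ext x; simp [codeDomain]
  rw [this]
  exact (MeasurableSet.iInter fun N => MeasurableSet.iUnion fun n =>
    measurableSet_block (fun l => N < l.length) _ _).inter
    (MeasurableSet.iInter fun N => MeasurableSet.iUnion fun n =>
      measurableSet_block (fun l => N < l.length) _ _)

variable [Countable Y] [MeasurableSpace Y]

theorem measurable_code : Measurable (code f) := by
  refine measurable_pi_lambda _ fun j => measurable_to_countable' fun y => ?_
  by_cases hj : 1 ≤ j
  · convert measurable_subtype_coe (MeasurableSet.iUnion fun n =>
      measurableSet_block (f := f) (fun l => l[(j - 1).toNat]? = some y) 1 n) using 1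
    ext z
    simp [code_eq_iff_of_pos z hj]
  · convert measurable_subtype_coe (MeasurableSet.iUnion fun m : ℕ =>
      measurableSet_block (f := f) (fun l => l.reverse[(-j).toNat]? = some y) (1 - m) m) using 1
    ext z
    simp [code_eq_iff_of_nonpos z hj]

theorem measurableSet_codePreimage {A : Set (ℤ → Y)} (hA : MeasurableSet A) :
    MeasurableSet (codePreimage f A) := by
  rw [codePreimage_eq_image]
  exact measurableSet_codeDomain.subtype_image (measurable_code hA)

theorem codedMeasure_apply (μ : Measure (ℤ → X)) {A : Set (ℤ → Y)} (hA : MeasurableSet A) :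
    codedMeasure f μ A = μ (codePreimage f A) := by
  rw [codedMeasure, Measure.map_apply measurable_code hA,
    comap_subtype_coe_apply measurableSet_codeDomain, codePreimage_eq_image]

theorem measurable_F {A : Set (ℤ → Y)} (hA : MeasurableSet A) (k : ℕ) : Measurable (F f A k) := by
  rw [F_eq_indicator]
  exact measurable_one.indicator (measurableSet_codePreimage ((measurable_shift.iterate k) hA))

theorem measurable_G {A : Set (ℤ → Y)} (hA : MeasurableSet A) : Measurable (G f A) := by
  have : Measurable fun q : (ℤ → X) × X => ∑ k ∈ Finset.range (f q.2).length, F f A k q.1 :=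
    measurable_from_prod_countable_left fun c =>
      Finset.measurable_fun_sum (Finset.range (f c).length) fun k _ => measurable_F hA k
  exact this.comp (measurable_id.prodMk (measurable_pi_apply 1))

theorem lintegral_F (μ : Measure (ℤ → X)) {A : Set (ℤ → Y)} (hA : MeasurableSet A) (k : ℕ) :
    ∫⁻ x, F f A k x ∂μ = codedMeasure f μ (shift^[k] ⁻¹' A) := by
  have hk := (measurable_shift.iterate k) hA
  rw [codedMeasure_apply μ hk, F_eq_indicator, lintegral_indicator_one
    (measurableSet_codePreimage hk)]

end Measurability

section Recurrence

variable {X Y : Type*} [MeasurableSpace X] [DiscreteMeasurableSpace X]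
  {f : X → List Y} {μ m : Measure (ℤ → X)}

theorem IsStationaryMean.ae_exists_lt_ne_nil [IsProbabilityMeasure μ] (h : IsStationaryMean μ m)
    (f : X → List Y) : ∀ᵐ x ∂μ, ∀ i, f (x i) ≠ [] → ∃ j < i, f (x j) ≠ [] := by
  have hmeas : ∀ i : ℤ, MeasurableSet {x : ℤ → X | f (x i) ≠ [] → ∃ j < i, f (x j) ≠ []} := by
    intro i
    have : {x : ℤ → X | f (x i) ≠ [] → ∃ j < i, f (x j) ≠ []} =
        {x | f (x i) = []} ∪ ⋃ j : ℤ, ⋃ _ : j < i, {x | f (x j) ≠ []} := by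
      ext x
      simp only [Set.mem_ofPred_eq, Set.mem_union, Set.mem_iUnion, exists_prop]
      tauto
    rw [this]
    exact (measurableSet_apply (fun c => f c = []) i).union (MeasurableSet.iUnion fun j =>
      MeasurableSet.iUnion fun _ => measurableSet_apply (fun c => f c ≠ []) j)
  have := h.isProbabilityMeasure
  refine (h.ae_iff_of_invariant ?_ fun x => ?_).1 (ae_all_iff.2 fun i => ?_)
  · rw [Set.ofPred_forall]
    exact MeasurableSet.iInter hmeas
  · constructor
    · intro hx i hi
      obtain ⟨j, hj, hj'⟩ := hx (i - 1) (by simpa [shift] using hi)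
      exact ⟨j + 1, by omega, hj'⟩
    · intro hx i hi
      obtain ⟨j, hj, hj'⟩ := hx (i + 1) hi
      exact ⟨j - 1, by omega, by simpa [shift] using hj'⟩
  · rw [ae_iff]
    by_contra hpos
    obtain ⟨x, hx, n, hn, hxn⟩ :=
      h.measurePreserving.exists_mem_iterate_mem (hmeas i).compl.nullMeasurableSet hpos
    refine hxn fun _ => ⟨i - n, by omega, ?_⟩
    rw [iterate_shift_apply, sub_add_cancel]
    by_contra hi
    exact hx fun hne => absurd hi hne

end Recurrence

section Interpolation

theorem tendsto_average_of_tendsto_average_comp {a : ℕ → ℝ≥0∞} (ha : ∀ k, a k ≤ 1) {S : ℕ → ℕ}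
    {l v : ℝ≥0∞} (hl0 : 0 < l) (hl : l < ∞)
    (hS : Tendsto (fun n : ℕ => (S n : ℝ≥0∞) / (n : ℝ≥0∞)) atTop (𝓝 l))
    (hv : Tendsto (fun n => (∑ k ∈ Finset.range (S n), a k) / (S n : ℝ≥0∞)) atTop (𝓝 v)) :
    Tendsto (fun n : ℕ => (∑ k ∈ Finset.range n, a k) / (n : ℝ≥0∞)) atTop (𝓝 v) := by
  have hle : ∀ n : ℕ, (∑ k ∈ Finset.range n, a k) / (n : ℝ≥0∞) ≤ 1 := fun n => by
    refine ENNReal.div_le_of_le_mul ?_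
    rw [one_mul]
    calc ∑ k ∈ Finset.range n, a k ≤ ∑ k ∈ Finset.range n, 1 := Finset.sum_le_sum fun k _ => ha k
      _ = n := by simp
  have hvtop : v ≠ ∞ :=
    ((le_of_tendsto' hv fun n => hle (S n)).trans_lt ENNReal.one_lt_top).ne
  have hsum : ∀ n : ℕ, ∑ k ∈ Finset.range n, a k ≠ ∞ := fun n =>
    ENNReal.sum_ne_top.2 fun k _ => ((ha k).trans_lt ENNReal.one_lt_top).ne
  refine (ENNReal.tendsto_toReal_iff (fun n => ((hle n).trans_lt ENNReal.one_lt_top).ne) hvtop).1 ?_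
  have hSr : Tendsto (fun n : ℕ => (S n : ℝ) / n) atTop (𝓝 l.toReal) := by
    simpa [Function.comp_def] using (ENNReal.tendsto_toReal hl.ne).comp hS
  have hvr : Tendsto (fun n => (∑ k ∈ Finset.range (S n), a k).toReal / (S n : ℝ)) atTop
      (𝓝 v.toReal) := by
    simpa [Function.comp_def] using (ENNReal.tendsto_toReal hvtop).comp hv
  have hL : 0 < l.toReal := ENNReal.toReal_pos hl0.ne' hl.ne
  have hSinf : Tendsto S atTop atTop := by
    rw [← tendsto_natCast_atTop_iff (R := ℝ)]
    refine (hSr.pos_mul_atTop hL tendsto_natCast_atTop_atTop).congr' ?_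
    filter_upwards [eventually_ge_atTop 1] with n hn
    have : (n : ℝ) ≠ 0 := by exact_mod_cast (by omega : n ≠ 0)
    field_simp
  have key := tendsto_div_of_monotone_of_exists_subseq_tendsto_div
    (fun n => (∑ k ∈ Finset.range n, a k).toReal) v.toReal
    (fun i j hij => ENNReal.toReal_mono (hsum j)
      (Finset.sum_le_sum_of_subset (Finset.range_mono hij)))
    fun b hb => ⟨S, ?_, hSinf, hvr⟩
  · simpa using key
  have h1 : Tendsto (fun n : ℕ => ((S (n + 1) : ℝ) / ((n + 1 : ℕ) : ℝ)) * (1 + 1 / (n : ℝ))) atTop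
      (𝓝 (l.toReal * (1 + 0))) :=
    (hSr.comp (tendsto_add_atTop_nat 1)).mul
      (tendsto_const_nhds.add tendsto_one_div_atTop_nhds_zero_nat)
  have h2 := hSr.const_mul b
  have hlt : l.toReal * (1 + 0) < b * l.toReal := by nlinarith
  filter_upwards [h1.eventually_lt h2 hlt, eventually_ge_atTop 1] with n hn hn1
  have hn0 : (0 : ℝ) < n := by exact_mod_cast hn1
  have e1 : ((S (n + 1) : ℝ) / ((n + 1 : ℕ) : ℝ)) * (1 + 1 / (n : ℝ)) = S (n + 1) / n := by
    push_cast
    field_simp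
  rw [e1, ← mul_div_assoc, div_lt_div_iff_of_pos_right hn0] at hn
  exact hn.le

end Interpolation

section Main

variable {X Y : Type*} {f : X → List Y}

theorem totalLength_div_eq_average (x : ℤ → X) (n : ℕ) :
    (totalLength f x n : ℝ≥0∞) / (n : ℝ≥0∞) =
      (∑ i ∈ Finset.range n, ((f (shift^[i] x 1)).length : ℝ≥0∞)) / (n : ℝ≥0∞) := by
  rw [totalLength_eq_sum, Nat.cast_sum]

theorem expansionRate_shift (x : ℤ → X) : expansionRate f (shift x) = expansionRate f x := by
  simp only [expansionRate, totalLength_div_eq_average]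
  exact limUnder_average_succ (c := fun i => ((f (shift^[i] x 1)).length : ℝ≥0∞))
    (ENNReal.natCast_ne_top _)

theorem limUnder_avgG_shift (A : Set (ℤ → Y)) (x : ℤ → X) :
    limUnder atTop (avgG f A (shift x)) = limUnder atTop (avgG f A x) :=
  limUnder_average_succ (c := fun i => G f A (shift^[i] x)) (G_ne_top A _)

theorem tendsto_freqF {x : ℤ → X} (hx : x ∈ codeDomain f) (A : Set (ℤ → Y)) {l g : ℝ≥0∞}
    (hl0 : 0 < l) (hl : l < ∞)
    (hS : Tendsto (fun n : ℕ => (totalLength f x n : ℝ≥0∞) / (n : ℝ≥0∞)) atTop (𝓝 l))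
    (hg : Tendsto (avgG f A x) atTop (𝓝 g)) : Tendsto (freqF f A x) atTop (𝓝 (l⁻¹ * g)) := by
  refine (ENNReal.Tendsto.mul hS.inv (Or.inl (ENNReal.inv_ne_zero.2 hl.ne)) hg
    (Or.inr (ENNReal.inv_ne_top.2 hl0.ne'))).congr' ?_
  filter_upwards [eventually_ge_atTop 1] with n hn
  have hn0 : (n : ℝ≥0∞) ≠ 0 := by exact_mod_cast (by omega : n ≠ 0)
  rw [avgG, freqF, sum_G_eq_sum_F hx, ENNReal.inv_div (Or.inl (ENNReal.natCast_ne_top n))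
    (Or.inl hn0), div_eq_mul_inv, div_eq_mul_inv, div_eq_mul_inv, mul_comm (n : ℝ≥0∞), mul_assoc,
    mul_left_comm (n : ℝ≥0∞), ENNReal.mul_inv_cancel hn0 (ENNReal.natCast_ne_top n), mul_one,
    mul_comm]

theorem mem_codeDomain_of_tendsto {x : ℤ → X} {l : ℝ≥0∞} (hl0 : 0 < l)
    (hS : Tendsto (fun n : ℕ => (totalLength f x n : ℝ≥0∞) / (n : ℝ≥0∞)) atTop (𝓝 l))
    (hleft : ∀ i, f (x i) ≠ [] → ∃ j < i, f (x j) ≠ []) : x ∈ codeDomain f := by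
  have hright : ∀ N : ℕ, ∃ n : ℕ, N < (block f x 1 n).length := by
    by_contra! h
    obtain ⟨N, hN⟩ := h
    refine hl0.ne' (tendsto_nhds_unique hS ?_)
    have h0 : Tendsto (fun n : ℕ => (N : ℝ≥0∞) / (n : ℝ≥0∞)) atTop (𝓝 0) := by
      have := ENNReal.Tendsto.const_mul (a := (N : ℝ≥0∞)) ENNReal.tendsto_inv_nat_nhds_zero
        (Or.inr (ENNReal.natCast_ne_top N))
      simpa [div_eq_mul_inv] using this
    refine tendsto_of_tendsto_of_tendsto_of_le_of_le tendsto_const_nhds h0 (fun _ => zero_le)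
      fun n => ENNReal.div_le_div_right ?_ _
    have := hN n
    rw [length_block_one_eq_totalLength] at this
    exact_mod_cast this
  refine ⟨hright, exists_lt_length_block_left ?_ hleft⟩
  obtain ⟨n, hn⟩ := hright 0
  by_contra! h
  rw [length_block_one_eq_totalLength, totalLength] at hn
  simp [h] at hn

variable [MeasurableSpace X]

theorem measurable_limUnder_average {φ : (ℤ → X) → ℝ≥0∞} (hφ : Measurable φ) :
    Measurable fun x => limUnder atTop fun n : ℕ =>
      (∑ i ∈ Finset.range n, φ (shift^[i] x)) / (n : ℝ≥0∞) :=
  (StronglyMeasurable.limUnder fun _ => ((Finset.measurable_fun_sum _ fun i _ =>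
    hφ.comp (measurable_shift.iterate i)).div_const _).stronglyMeasurable).measurable

variable [DiscreteMeasurableSpace X]

theorem measurable_length_apply_one :
    Measurable fun x : ℤ → X => ((f (x 1)).length : ℝ≥0∞) :=
  (Measurable.of_discrete (f := fun c : X => ((f c).length : ℝ≥0∞))).comp (measurable_pi_apply 1)

theorem measurable_expansionRate : Measurable (expansionRate f) := by
  have := measurable_limUnder_average (measurable_length_apply_one (f := f))
  simp only [← totalLength_div_eq_average] at this
  exact this

end Main

end AMSCoding

theorem mainTheorem2 {X Y : Type*} [Countable X] [MeasurableSpace X] [DiscreteMeasurableSpace X]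
    [Countable Y] [MeasurableSpace Y] [DiscreteMeasurableSpace Y]
    (f : X → List Y) (μ : Measure (ℤ → X)) [IsProbabilityMeasure μ]
    (hμ : AMSCoding.IsAMS μ)
    (hl : ∀ᵐ x ∂μ, 0 < AMSCoding.expansionRate f x ∧ AMSCoding.expansionRate f x < ∞) :
    (∀ᵐ x ∂μ, x ∈ AMSCoding.codeDomain f) ∧
    IsProbabilityMeasure (AMSCoding.codedMeasure f μ) ∧
    AMSCoding.IsAMS (AMSCoding.codedMeasure f μ) ∧
    ∃ (μbar : Measure (ℤ → X)) (νbar : Measure (ℤ → Y)),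
      AMSCoding.IsStationaryMean μ μbar ∧
      AMSCoding.IsStationaryMean (AMSCoding.codedMeasure f μ) νbar ∧
      MeasurePreserving AMSCoding.shift μbar μbar ∧
      MeasurePreserving AMSCoding.shift νbar νbar ∧
      (∀ᵐ x ∂μ, Tendsto
        (fun n : ℕ => (AMSCoding.totalLength f x n : ℝ≥0∞) / (n : ℝ≥0∞)) atTop
        (𝓝 (AMSCoding.expansionRate f x))) ∧
      (∀ᵐ x ∂μbar, Tendsto
        (fun n : ℕ => (AMSCoding.totalLength f x n : ℝ≥0∞) / (n : ℝ≥0∞)) atTop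
        (𝓝 (AMSCoding.expansionRate f x))) ∧
      ∀ A : Set (ℤ → Y), MeasurableSet A →
        (∀ᵐ x ∂μ, ∃ a : ℝ≥0∞, Tendsto (AMSCoding.freqF f A x) atTop (𝓝 a)) ∧
        (∀ᵐ x ∂μ, ∃ a : ℝ≥0∞, Tendsto (AMSCoding.avgG f A x) atTop (𝓝 a)) ∧
        (∀ᵐ x ∂μbar, ∃ a : ℝ≥0∞, Tendsto (AMSCoding.avgG f A x) atTop (𝓝 a)) ∧
        νbar A = ∫⁻ x, limUnder atTop (AMSCoding.freqF f A x) ∂μ ∧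
        νbar A = ∫⁻ x, (AMSCoding.expansionRate f x)⁻¹ *
          limUnder atTop (AMSCoding.avgG f A x) ∂μ ∧
        νbar A = ∫⁻ x, (AMSCoding.expansionRate f x)⁻¹ *
          limUnder atTop (AMSCoding.avgG f A x) ∂μbar := by
  obtain ⟨μbar, hbar⟩ := hμ.exists_isStationaryMean
  have hrate := hbar.ae_exists_tendsto_average (AMSCoding.measurable_length_apply_one (f := f))
    fun x => ENNReal.natCast_ne_top _
  simp only [← AMSCoding.totalLength_div_eq_average] at hrate
  have hrateμ : ∀ᵐ x ∂μ, Tendsto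
      (fun n : ℕ => (AMSCoding.totalLength f x n : ℝ≥0∞) / (n : ℝ≥0∞)) atTop
      (𝓝 (AMSCoding.expansionRate f x)) := hrate.2.mono fun x hx => tendsto_nhds_limUnder hx
  have hdom : ∀ᵐ x ∂μ, x ∈ AMSCoding.codeDomain f := by
    filter_upwards [hrateμ, hl, hbar.ae_exists_lt_ne_nil f] with x h1 h2 h3
    exact AMSCoding.mem_codeDomain_of_tendsto h2.1 h1 h3
  have hG : ∀ A : Set (ℤ → Y), MeasurableSet A →
      (∀ᵐ x ∂μbar, ∃ a : ℝ≥0∞, Tendsto (AMSCoding.avgG f A x) atTop (𝓝 a)) ∧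
      ∀ᵐ x ∂μ, ∃ a : ℝ≥0∞, Tendsto (AMSCoding.avgG f A x) atTop (𝓝 a) := fun A hA =>
    hbar.ae_exists_tendsto_average (AMSCoding.measurable_G hA) (AMSCoding.G_ne_top A)
  have hfreq : ∀ A : Set (ℤ → Y), MeasurableSet A → ∀ᵐ x ∂μ, Tendsto (AMSCoding.freqF f A x) atTop
      (𝓝 ((AMSCoding.expansionRate f x)⁻¹ * limUnder atTop (AMSCoding.avgG f A x))) := by
    intro A hA
    filter_upwards [hrateμ, hl, hdom, (hG A hA).2] with x h1 h2 h3 h4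
    exact AMSCoding.tendsto_freqF h3 A h2.1 h2.2 h1 (tendsto_nhds_limUnder h4)
  have hces : ∀ A : Set (ℤ → Y), MeasurableSet A →
      Tendsto (AMSCoding.cesaro (AMSCoding.codedMeasure f μ) A) atTop
        (𝓝 (∫⁻ x, (AMSCoding.expansionRate f x)⁻¹ *
          limUnder atTop (AMSCoding.avgG f A x) ∂μ)) := by
    intro A hA
    have hmeas : ∀ n : ℕ, Measurable fun x =>
        (∑ k ∈ Finset.range n, AMSCoding.F f A k x) / (n : ℝ≥0∞) := fun n =>
      (Finset.measurable_fun_sum _ fun k _ => AMSCoding.measurable_F hA k).div_const _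
    have hint : ∀ n : ℕ, ∫⁻ x, (∑ k ∈ Finset.range n, AMSCoding.F f A k x) / (n : ℝ≥0∞) ∂μ =
        AMSCoding.cesaro (AMSCoding.codedMeasure f μ) A n := fun n => by
      simp only [div_eq_mul_inv, AMSCoding.cesaro]
      rw [lintegral_mul_const _ (Finset.measurable_fun_sum _ fun k _ => AMSCoding.measurable_F hA k),
        lintegral_finsetSum _ fun k _ => AMSCoding.measurable_F hA k]
      simp only [AMSCoding.lintegral_F μ hA]
    refine Tendsto.congr hint (tendsto_lintegral_of_dominated_convergence (fun _ => 1) hmeas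
      (fun n => Eventually.of_forall fun x => ?_) (by simp) ?_)
    · refine ENNReal.div_le_of_le_mul ?_
      rw [one_mul]
      exact (Finset.sum_le_sum fun k _ => AMSCoding.F_le_one A k x).trans (by simp)
    · filter_upwards [hrateμ, hl, hfreq A hA] with x h1 h2 h3
      exact AMSCoding.tendsto_average_of_tendsto_average_comp
        (fun k => AMSCoding.F_le_one A k x) h2.1 h2.2 h1 h3
  have hams : AMSCoding.IsAMS (AMSCoding.codedMeasure f μ) := fun A hA => ⟨_, hces A hA⟩
  have hprob : IsProbabilityMeasure (AMSCoding.codedMeasure f μ) := ⟨by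
    rw [AMSCoding.codedMeasure_apply μ MeasurableSet.univ]
    have : AMSCoding.codePreimage f (Set.univ : Set (ℤ → Y)) = AMSCoding.codeDomain f := by
      ext x; simp [AMSCoding.codePreimage]
    rw [this]
    exact (prob_compl_eq_zero_iff AMSCoding.measurableSet_codeDomain).1 hdom⟩
  obtain ⟨νbar, hνbar⟩ := hams.exists_isStationaryMean
  have hν : ∀ A : Set (ℤ → Y), MeasurableSet A → νbar A = ∫⁻ x, (AMSCoding.expansionRate f x)⁻¹ *
      limUnder atTop (AMSCoding.avgG f A x) ∂μ := fun A hA =>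
    tendsto_nhds_unique (hνbar A hA) (hces A hA)
  refine ⟨hdom, hprob, hams, μbar, νbar, hbar, hνbar, hbar.measurePreserving,
    hνbar.measurePreserving, hrateμ, hrate.1.mono fun x hx => tendsto_nhds_limUnder hx,
    fun A hA => ⟨(hfreq A hA).mono fun x hx => ⟨_, hx⟩, (hG A hA).2, (hG A hA).1, ?_, hν A hA, ?_⟩⟩
  · rw [hν A hA]
    exact lintegral_congr_ae ((hfreq A hA).mono fun x hx => hx.limUnder_eq.symm)
  · rw [hν A hA]
    refine (hbar.lintegral_eq_of_invariant (AMSCoding.measurable_expansionRate.inv.mul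
      (AMSCoding.measurable_limUnder_average (AMSCoding.measurable_G hA))) fun x => ?_).symm
    change (AMSCoding.expansionRate f (AMSCoding.shift x))⁻¹ *
      limUnder atTop (AMSCoding.avgG f A (AMSCoding.shift x)) = _
    rw [AMSCoding.expansionRate_shift, AMSCoding.limUnder_avgG_shift]
    rfl
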